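/- Let $X$ be a Brady--Meier tubular graph of graphs, let $E$ be the number of its vertical edges and $F$ the number of its squares, and let $k\ge 1$ be an integer. Let $C$ be a vertical UC-separating cycle in $X$ of length at least $E(k-1)2^{F(F+1)/2}+1$. Then $C$ is $k$-repetitive. The terms are as follows. A *tubular graph of graphs* is a finite connected graph of spaces in which each vertex space is a finite connected simplicial graph, each edge space is a simplicial graph homeomorphic to a circle, and the attaching maps are simplicial immersions. Its geometric realisation, also denoted $X$, is a square complex: the *vertical* edges are the edges of the vertex graphs, the horizontal edges come from the vertices of the circles, and each edge of each circle, times $[0,1]$, is a square. $X$ is *Brady--Meier* if the link of each vertex is connected and remains connected after removing any simplex. A *vertical cycle* is an immersion $C\to X_s$ of a subdivided circle into a vertex graph $X_s$; its length is its number of edges. It is *UC-separating* if its lift $\widetilde C$ to the universal cover $\widetilde X$ separates $\widetilde X$, i.e. $\widetilde X\setminus\widetilde C$ is not connected. A *fundamental domain* of $C$ is an immersed combinatorial path $P_C\to X_s$ whose initial and terminal vertices $u,v$ have the same image, whose initial and terminal edges $a,b$ have distinct images, and such that gluing $u$ to $v$ gives a cycle isomorphic to $C$ over $X_s$. The *regular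 neighbourhood* $N(P)$ of a combinatorial path $\rho:P\to X$ is the square complex formed by the closed cells of the second cubical subdivision $X^{(2)}$ meeting $\rho(P)$, with one copy of a cell $c$ for each component of $\rho^{-1}(c)$, glued as the corresponding arcs of $P$ are; the *regular sphere* $\partial N(P)$ is the union of the cells of $N(P)$ disjoint from $P$. Let $b_u$ be the vertex of $\partial N(P_C)$ on the half-edge at $u$ given by the terminal edge $b$, and $a_v$ the vertex on the half-edge at $v$ given by the initial edge $a$. The *orthogonal sphere* $\partial_{orth}N(P_C)$ is the closure in the graph $\partial N(P_C)$ of the complement of $\{b_u\}^{+2}\cup\{a_v\}^{+2}$, where $\{x\}^{+2}$ is the union of all cells that meet the union of all closed cells containing $x$. A UC-separating vertical cycle $C$ is *$k$-repetitive* if there are a vertical edge $e$ of $X$ and a fundamental domain $P_C$ of $C$ such that (1) at least $k$ distinct edges $e_1,\dots,e_k$ of $P_C$ are mapped to $e$, and (2) for each square $\mathsf s$ containing $e$ there is a component $K$ of $\partial_{orth}N(P_C)$ such that, for each $i\in\{1,\dots,k\}$, the pre-image of $\mathsf s$ around $e_i$ (the segment of $\partial N(P_C)$ parallel to $e_i$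 in the copy of $\mathsf s$ at $e_i$) lies in $K$. Here a square both of whose vertical sides are glued to $e$ counts, in (2) only, as two squares containing $e$, one for each side. -/

import Mathlib

universe u v

/-- A tubular graph of graphs: a finite connected graph of spaces whose vertex spaces are finite
connected simplicial graphs, whose edge spaces are simplicial circles, and whose attaching maps are
simplicial immersions.

* `graph` is the disjoint union of the vertex graphs, so that the vertex graphs are its connected
  components;
* `A` is the set of edges of the underlying graph, and the edge space of `a : A` is the circle with
  vertex set `ZMod (len a)`, subdivided into `len a ≥ 3` edges `[i, i + 1]`;
* `attach a false` and `attach a true` are the attaching maps at the two ends of the tube of `a`. -/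
structure TubularGraphOfGraphs (V : Type u) (A : Type v) where
  finite_V : Finite V
  finite_A : Finite A
  graph : SimpleGraph V
  len : A → ℕ
  three_le_len : ∀ a, 3 ≤ len a
  attach : (a : A) → Bool → ZMod (len a) → V
  attach_adj : ∀ a ε i, graph.Adj (attach a ε i) (attach a ε (i + 1))
  attach_immersion : ∀ a ε i, attach a ε i ≠ attach a ε (i + 2)
  /-- The underlying graph, whose vertices are the vertex graphs, is connected. -/
  underlying_connected :
    (SimpleGraph.fromRel fun c d : graph.ConnectedComponent =>
      ∃ a, c = graph.connectedComponentMk (attach a false 0) ∧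
        d = graph.connectedComponentMk (attach a true 0)).Connected

namespace TubularGraphOfGraphs

variable {V : Type u} {A : Type v} (X : TubularGraphOfGraphs V A)

/-! ### The square complex -/

/-- The squares of the geometric realisation: `⟨a, i⟩` is the product of the edge `[i, i + 1]` of
the circle of `a` with the unit interval. -/
abbrev Square : Type v := Σ a : A, ZMod (X.len a)

/-- The number of vertical edges, i.e. of edges of the vertex graphs. -/
noncomputable def numVerticalEdges : ℕ := Nat.card X.graph.edgeSet

/-- The number of squares. -/
noncomputable def numSquares : ℕ := Nat.card X.Square

/-- A vertical side of a square. A square has two of them, one for each end of its tube. -/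
structure Side where
  a : A
  i : ZMod (X.len a)
  ε : Bool

variable {X} in
/-- The (oriented) vertical edge of `X` along which a side of a square is attached. -/
def Side.dart (s : X.Side) : X.graph.Dart :=
  ⟨(X.attach s.a s.ε s.i, X.attach s.a s.ε (s.i + 1)), X.attach_adj s.a s.ε s.i⟩

variable {X} in
/-- The vertical edge of `X` along which a side of a square is attached. -/
def Side.edge (s : X.Side) : Sym2 V := s.dart.edge

/-- The half-edges of the square complex. A vertical half-edge is the initial half of an oriented
vertical edge; `horizontal a i ε` is the half, at the end `ε`, of the horizontal edge
`{i} × [0, 1]` of the tube of `a`. -/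
inductive HalfEdge where
  | vertical (d : X.graph.Dart)
  | horizontal (a : A) (i : ZMod (X.len a)) (ε : Bool)

variable {X} in
/-- The vertex to which a half-edge is incident. -/
def HalfEdge.origin : X.HalfEdge → V
  | .vertical d => d.fst
  | .horizontal a i ε => X.attach a ε i

/-- The corners of the squares. The corner `⟨s, false⟩` is at the initial vertex of the side `s`,
and `⟨s, true⟩` is at its terminal vertex. -/
structure Corner where
  side : X.Side
  δ : Bool

variable {X} in
/-- The vertical half-edge of a corner (given by the corresponding oriented edge). -/
def Corner.vert (c : X.Corner) : X.graph.Dart :=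
  if c.δ then c.side.dart.symm else c.side.dart

variable {X} in
/-- The horizontal half-edge of a corner. -/
def Corner.horiz (c : X.Corner) : X.HalfEdge :=
  .horizontal c.side.a (if c.δ then c.side.i + 1 else c.side.i) c.side.ε

/-- The link of a vertex `v`: its vertices are the half-edges at `v`, and two of them are joined
whenever they are the two half-edges of a corner of a square. -/
def link (v : V) : SimpleGraph {h : X.HalfEdge // h.origin = v} :=
  SimpleGraph.fromRel fun h h' =>
    ∃ c : X.Corner, h.1 = HalfEdge.vertical c.vert ∧ h'.1 = c.horiz

/-- `X` is Brady-Meier: each vertex link is connected, and remains so after the removal of any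
simplex. As links here are bipartite graphs without multiple edges, the vertex sets of simplices
are exactly the nonempty cliques, i.e. single vertices and pairs of adjacent vertices. -/
def IsBradyMeier : Prop :=
  ∀ v : V, (X.link v).Connected ∧
    ∀ σ : Set {h : X.HalfEdge // h.origin = v}, σ.Nonempty → (X.link v).IsClique σ →
      ((X.link v).induce σᶜ).Connected

/-! ### The geometric realisation -/

open scoped unitInterval

/-- The disjoint union of the cells: points, (oriented) vertical edges `[0, 1]`, and squares
`[0, 1] × [0, 1]`, in which the first coordinate is vertical (along the circle of the tube) and the
second is horizontal (across the tube). -/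
abbrev CellSum : Type (max u v) :=
  (Σ _ : V, Unit) ⊕ (Σ _ : X.graph.Dart, I) ⊕ (Σ _ : X.Square, I × I)

variable {X} in
/-- A vertex. -/
def ptVertex (w : V) : X.CellSum := .inl ⟨w, ()⟩

variable {X} in
/-- A point of an oriented vertical edge. -/
def ptEdge (d : X.graph.Dart) (x : I) : X.CellSum := .inr (.inl ⟨d, x⟩)

variable {X} in
/-- A point of a square. -/
def ptSquare (q : X.Square) (x t : I) : X.CellSum := .inr (.inr ⟨q, x, t⟩)

/-- The gluing of the cells. -/
inductive Glue : X.CellSum → X.CellSum → Prop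
  | edge_start (d : X.graph.Dart) : Glue (ptEdge d 0) (ptVertex d.fst)
  | edge_symm (d : X.graph.Dart) (x : I) : Glue (ptEdge d x) (ptEdge d.symm (σ x))
  | side (s : X.Side) (x : I) :
      Glue (ptSquare ⟨s.a, s.i⟩ x (if s.ε then 1 else 0)) (ptEdge s.dart x)
  | next (a : A) (i : ZMod (X.len a)) (t : I) :
      Glue (ptSquare ⟨a, i⟩ 1 t) (ptSquare ⟨a, i + 1⟩ 0 t)

/-- The geometric realisation of `X`, with the quotient topology. -/
abbrev Realization : Type (max u v) := Quot X.Glue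

/-- A universal cover of (the geometric realisation of) `X`. -/
structure UniversalCover where
  space : Type (max u v)
  [top : TopologicalSpace space]
  proj : space → X.Realization
  isCoveringMap : IsCoveringMap proj
  simplyConnected : SimplyConnectedSpace space

attribute [instance] UniversalCover.top

/-! ### Vertical cycles and paths -/

/-- A vertical cycle: an immersion into a vertex graph of a circle subdivided into `len` edges. -/
structure Cycle where
  len : ℕ
  len_pos : 0 < len
  vertex : ZMod len → V
  adj : ∀ i, X.graph.Adj (vertex i) (vertex (i + 1))
  immersed : ∀ i, vertex i ≠ vertex (i + 2)

variable {X} in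
/-- The composition of the universal covering `ℝ → C` of a vertical cycle `C` with `C → X`; the
integers are sent to vertices. -/
noncomputable def Cycle.line (C : X.Cycle) (x : ℝ) : X.Realization :=
  Quot.mk _ (ptEdge ⟨(C.vertex (⌊x⌋ : ℤ), C.vertex ((⌊x⌋ : ℤ) + 1)), C.adj _⟩
    ⟨Int.fract x, Int.fract_nonneg x, (Int.fract_lt_one x).le⟩)

variable {X} in
/-- A vertical cycle is UC-separating if its lift to the universal cover (which is a line in a
vertical tree) separates the universal cover. Universal covers are unique up to isomorphism, and
any two lifts differ by a deck transformation. -/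
def Cycle.IsUCSeparating (C : X.Cycle) : Prop :=
  ∃ (Y : X.UniversalCover) (L : C(ℝ, Y.space)),
    (∀ x, Y.proj (L x) = C.line x) ∧ ¬ IsPreconnected (Set.range L)ᶜ

/-- A vertical path of `X`: an immersed combinatorial path in a vertex graph, with `len` edges. -/
structure VerticalPath where
  len : ℕ
  vertex : Fin (len + 1) → V
  adj : ∀ j : Fin len, X.graph.Adj (vertex j.castSucc) (vertex j.succ)
  immersed : ∀ i j : Fin len, (j : ℕ) = i + 1 → vertex i.castSucc ≠ vertex j.succ

namespace VerticalPath

variable {X} (P : X.VerticalPath)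

/-- The image in `X` of the `j`-th edge of the path, oriented along the path. -/
def dart (j : Fin P.len) : X.graph.Dart := ⟨(P.vertex j.castSucc, P.vertex j.succ), P.adj j⟩

/-- The image in `X` of the `j`-th edge of the path. -/
def edge (j : Fin P.len) : Sym2 V := (P.dart j).edge

/-- The half-edge `h` of `X` is, at the `j`-th vertex of the path, the image of a half-edge of the
path. -/
def Uses (j : Fin (P.len + 1)) (h : X.HalfEdge) : Prop :=
  ∃ i : Fin P.len, (j = i.castSucc ∧ h = .vertical (P.dart i)) ∨
    (j = i.succ ∧ h = .vertical (P.dart i).symm)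

/-- The vertices of the regular sphere `∂N(P)`. The regular neighbourhood `N(P)` consists of the
cells of the second cubical subdivision of `X` along `P` (with one copy for each passage of `P`),
and `∂N(P)` consists of the cells of `N(P)` that are disjoint from `P`. So its vertices are

* `onHalfEdge j h`: the point at distance `1/4` from the `j`-th vertex of `P` on a half-edge `h`
  that does not lie in `P`;
* `inCorner j c`: the vertex opposite to the `j`-th vertex of `P` in the small square at a corner
  `c` neither of whose half-edges lies in `P`;
* `along j s t`: the points `t = 0, 1, 2` at distance `1/4` from the three interior subdivision
  points of the `j`-th edge of `P`, in a square having a side `s` attached along this edge. -/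
inductive SphereVertex : Type (max u v)
  | onHalfEdge (j : Fin (P.len + 1)) (h : X.HalfEdge) (origin : h.origin = P.vertex j)
      (off : ¬ P.Uses j h)
  | inCorner (j : Fin (P.len + 1)) (c : X.Corner) (origin : c.vert.fst = P.vertex j)
      (off : ¬ P.Uses j (.vertical c.vert))
  | along (j : Fin P.len) (s : X.Side) (mem : s.edge = P.edge j) (t : Fin 3)

/-- The edges of the regular sphere. In a square having a side `s` attached along the `j`-th edge
of `P`, they form a segment of four edges parallel to that edge, whose endpoints lie on the two
horizontal edges of the square. -/
inductive SphereRel : P.SphereVertex → P.SphereVertex → Prop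
  | corner_vert (j c ho hoff ho' hoff') :
      SphereRel (.inCorner j c ho hoff) (.onHalfEdge j (.vertical c.vert) ho' hoff')
  | corner_horiz (j c ho hoff ho' hoff') :
      SphereRel (.inCorner j c ho hoff) (.onHalfEdge j c.horiz ho' hoff')
  | along_start (j : Fin P.len) (c : X.Corner) (hc : c.vert = P.dart j) (hmem ho hoff) :
      SphereRel (.onHalfEdge j.castSucc c.horiz ho hoff) (.along j c.side hmem 0)
  | along_zero (j s hmem) : SphereRel (.along j s hmem 0) (.along j s hmem 1)
  | along_one (j s hmem) : SphereRel (.along j s hmem 1) (.along j s hmem 2)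
  | along_end (j : Fin P.len) (c : X.Corner) (hc : c.vert = (P.dart j).symm) (hmem ho hoff) :
      SphereRel (.along j c.side hmem 2) (.onHalfEdge j.succ c.horiz ho hoff)

/-- The regular sphere `∂N(P)` around a vertical path. -/
def regularSphere : SimpleGraph P.SphereVertex := SimpleGraph.fromRel P.SphereRel

/-- The pre-image, around the `j`-th edge of `P`, of a square having the side `s` attached along
this edge: the set of the vertices of the segment of `∂N(P)` that is parallel to the edge in this
square. -/
def squarePreimage (j : Fin P.len) (s : X.Side) : Set P.SphereVertex :=
  {x | (∃ hmem t, x = .along j s hmem t) ∨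
    (∃ (c : X.Corner) (ho : _) (hoff : _), c.side = s ∧ c.vert = P.dart j ∧
      x = .onHalfEdge j.castSucc c.horiz ho hoff) ∨
    (∃ (c : X.Corner) (ho : _) (hoff : _), c.side = s ∧ c.vert = (P.dart j).symm ∧
      x = .onHalfEdge j.succ c.horiz ho hoff)}

end VerticalPath

/-- A cyclic path: a closed vertical path whose initial and terminal edges have distinct images. -/
structure CyclicPath extends X.VerticalPath where
  len_pos : 0 < len
  closed : vertex 0 = vertex (Fin.last len)
  ends : toVerticalPath.edge ⟨0, len_pos⟩ ≠ toVerticalPath.edge ⟨len - 1, Nat.sub_one_lt_of_lt len_pos⟩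

end TubularGraphOfGraphs

/-! ### Subgraphs -/

/-- The first cubical neighbourhood of a subgraph: the union of all cells that meet it. -/
def SimpleGraph.Subgraph.cubicalNbhd {W : Type*} {G : SimpleGraph W} (H : G.Subgraph) :
    G.Subgraph where
  verts := {x | x ∈ H.verts ∨ ∃ y ∈ H.verts, G.Adj x y}
  Adj x y := G.Adj x y ∧ (x ∈ H.verts ∨ y ∈ H.verts)
  adj_sub h := h.1
  edge_vert := by
    rintro x y ⟨h, hx | hy⟩
    · exact Or.inl hx
    · exact Or.inr ⟨y, hy, h⟩
  symm := ⟨fun _ _ h => ⟨h.1.symm, h.2.symm⟩⟩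

/-- The closure of the complement of a subgraph `H`: the union of the vertices not in `H` and of the
closed edges not in `H`. -/
def SimpleGraph.Subgraph.closureCompl {W : Type*} {G : SimpleGraph W} (H : G.Subgraph) :
    G.Subgraph where
  verts := {x | x ∉ H.verts ∨ ∃ y, G.Adj x y ∧ ¬ H.Adj x y}
  Adj x y := G.Adj x y ∧ ¬ H.Adj x y
  adj_sub h := h.1
  edge_vert := fun {_ y} h => Or.inr ⟨y, h⟩
  symm := ⟨fun _ _ h => ⟨h.1.symm, fun h' => h.2 h'.symm⟩⟩

namespace TubularGraphOfGraphs

variable {V : Type u} {A : Type v} {X : TubularGraphOfGraphs V A}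

namespace CyclicPath

variable (P : X.CyclicPath)

/-- The index of the initial edge. -/
def first : Fin P.len := ⟨0, P.len_pos⟩

/-- The index of the terminal edge. -/
def last : Fin P.len := ⟨P.len - 1, Nat.sub_one_lt_of_lt P.len_pos⟩

theorem last_succ : P.last.succ = Fin.last P.len := by
  have := P.len_pos
  ext
  simp only [last, Fin.val_succ, Fin.val_last]
  omega

theorem first_castSucc : P.first.castSucc = 0 := by
  ext
  simp [first]

/-- The vertex of `∂N(u)`, `u` the initial vertex of `P`, on the terminal edge of `P`. -/
def bu : P.SphereVertex :=
  .onHalfEdge 0 (.vertical (P.dart P.last).symm)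
    (by
      change P.vertex P.last.succ = P.vertex 0
      rw [last_succ, P.closed])
    (by
      rintro ⟨i, ⟨hi, h⟩ | ⟨hi, -⟩⟩
      · have hi' : i = P.first := by
          ext
          simpa [first] using (congrArg Fin.val hi).symm
        subst hi'
        refine P.ends ?_
        have h1 := HalfEdge.vertical.inj h
        change (P.dart P.first).edge = (P.dart P.last).edge
        rw [← h1, SimpleGraph.Dart.edge_symm]
      · exact absurd hi.symm (Fin.succ_ne_zero i))

/-- The vertex of `∂N(v)`, `v` the terminal vertex of `P`, on the initial edge of `P`. -/
def av : P.SphereVertex :=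
  .onHalfEdge (Fin.last P.len) (.vertical (P.dart P.first))
    (by
      change P.vertex P.first.castSucc = P.vertex (Fin.last P.len)
      rw [first_castSucc, P.closed])
    (by
      rintro ⟨i, ⟨hi, -⟩ | ⟨hi, h⟩⟩
      · have := congrArg Fin.val hi
        simp only [Fin.val_last, Fin.val_castSucc] at this
        omega
      · have hi' : i = P.last := by
          have := congrArg Fin.val hi
          simp only [Fin.val_last, Fin.val_succ] at this
          ext
          simp only [last]
          omega
        subst hi'
        refine P.ends ?_
        have h1 := HalfEdge.vertical.inj h
        change (P.dart P.first).edge = (P.dart P.last).edge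
        rw [h1, SimpleGraph.Dart.edge_symm])

/-- The orthogonal sphere `∂_orth N(P)`: the closure in `∂N(P)` of the complement of the second
cubical neighbourhoods of `bu` and `av`. -/
def orthogonalSphere : P.regularSphere.Subgraph :=
  ((P.regularSphere.singletonSubgraph P.bu).cubicalNbhd.cubicalNbhd ⊔
    (P.regularSphere.singletonSubgraph P.av).cubicalNbhd.cubicalNbhd).closureCompl

/-- `P` is a fundamental domain of the cycle `C`: the quotient cycle of `P` is isomorphic to `C`
over `X`. The isomorphisms between subdivided circles are the rotations and the reflections. -/
def IsFundamentalDomain (P : X.CyclicPath) (C : X.Cycle) : Prop :=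
  P.len = C.len ∧ ∃ c : ZMod C.len,
    (∀ j : Fin (P.len + 1), P.vertex j = C.vertex (c + (j : ℕ))) ∨
    (∀ j : Fin (P.len + 1), P.vertex j = C.vertex (c - (j : ℕ)))

end CyclicPath

/-- `C` is `k`-repetitive: it is UC-separating, and there are a vertical edge `e` of `X`, a
fundamental domain `P` of `C` and `k` distinct edges of `P` that are mapped to `e`, such that for
each square containing `e` there is a component `K` of the orthogonal sphere around `P` that
contains the pre-images of this square around all of these `k` edges.

A square both of whose vertical sides are attached along `e` counts here as two squares containing
`e`, one for each of its sides (as it does in the universal cover). -/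
def Cycle.IsRepetitive (C : X.Cycle) (k : ℕ) : Prop :=
  C.IsUCSeparating ∧
    ∃ e ∈ X.graph.edgeSet, ∃ P : X.CyclicPath, P.IsFundamentalDomain C ∧
      ∃ i : Fin k ↪ Fin P.len, (∀ m, P.edge (i m) = e) ∧
        ∀ s : X.Side, s.edge = e →
          ∃ K : P.orthogonalSphere.coe.ConnectedComponent,
            ∀ m, P.squarePreimage (i m) s ⊆ Subtype.val '' K.supp

end TubularGraphOfGraphs

/-!
The squares around an edge of a fundamental domain `P` are distributed among the components of the
orthogonal sphere; this distribution is regarded as a colouring of the sides attached along the edge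
(`CyclicPath.sideComponent`). Repetitivity asks for `k` edges of `P` over the same edge of `X` and
with the same colouring, so the theorem is a matter of counting colourings.

The number of colours is small because every component which occurs at one edge of `P` occurs at all
of them (`CyclicPath.range_sideComponent_eq`). Indeed, let `x` be an interior vertex of `P` lying
between two consecutive edges of `P`. Around `x`, the regular sphere is the (subdivided) link of the
image of `x`, without its two vertices that are given by `P`. By the Brady-Meier condition the link
stays connected if only one of these two vertices is removed, so that from each square around the
first edge one can reach, avoiding both vertices, a square around the second one, and conversely
(`CyclicPath.exists_corner_mem`). The cells removed in order to form the orthogonal sphere are all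
close to the end vertices of `P`, and do not interfere.

Hence the number `c` of colours is at most the number of sides attached along any edge traversed by
`P`. Three consecutive edges of `P` have distinct images because the vertex graphs are simplicial and
`P` is immersed. As there are `2F` sides in total, an edge along which `n` sides are attached
satisfies `n + 2c ≤ 2F`, and so it has at most `c ^ n ≤ 2 ^ ((c - 1) n) ≤ 2 ^ (F (F + 1) / 2)`
colourings. The pigeonhole principle, applied first to the edges of `X` and then to the colourings,
concludes. The lift to the universal cover plays no role in the counting.
-/

namespace TubularGraphOfGraphs

variable {V : Type u} {A : Type v} {X : TubularGraphOfGraphs V A}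

/-! ### Counting sides -/

/-- A side amounts to a square and an end of its tube. -/
def sideEquiv (X : TubularGraphOfGraphs V A) : X.Side ≃ X.Square × Bool where
  toFun s := (⟨s.a, s.i⟩, s.ε)
  invFun p := ⟨p.1.1, p.1.2, p.2⟩
  left_inv _ := rfl
  right_inv _ := rfl

theorem finite_side (X : TubularGraphOfGraphs V A) : Finite X.Side := by
  have := X.finite_A
  have (a : A) : NeZero (X.len a) := ⟨by have := X.three_le_len a; omega⟩
  exact Finite.of_equiv _ X.sideEquiv.symm

theorem card_side (X : TubularGraphOfGraphs V A) : Nat.card X.Side = 2 * X.numSquares := by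
  rw [Nat.card_congr X.sideEquiv, Nat.card_prod, numSquares]
  simp [mul_comm]

theorem card_sides_add_three_le {e₁ e₂ e₃ : Sym2 V} (h₁₂ : e₁ ≠ e₂) (h₁₃ : e₁ ≠ e₃)
    (h₂₃ : e₂ ≠ e₃) :
    Nat.card {s : X.Side // s.edge = e₁} + Nat.card {s : X.Side // s.edge = e₂} +
      Nat.card {s : X.Side // s.edge = e₃} ≤ 2 * X.numSquares := by
  have := X.finite_side
  rw [← card_side, ← Nat.card_sum, ← Nat.card_sum]
  refine Nat.card_le_card_of_injective
    (Sum.elim (Sum.elim Subtype.val Subtype.val) Subtype.val) ?_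
  rintro ((⟨s, hs⟩ | ⟨s, hs⟩) | ⟨s, hs⟩) ((⟨t, ht⟩ | ⟨t, ht⟩) | ⟨t, ht⟩) h <;>
    simp only [Sum.elim_inl, Sum.elim_inr] at h <;> subst h <;>
    first | rfl | exact absurd (hs.symm.trans ht) (by simp_all [eq_comm])

/-- A side which is attached along the edge of a dart has a corner at the origin of the dart. -/
theorem exists_corner (s : X.Side) (d : X.graph.Dart) (h : s.edge = d.edge) :
    ∃ c : X.Corner, c.side = s ∧ c.vert = d := by
  rcases SimpleGraph.dart_edge_eq_iff _ _ |>.1 h with h | h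
  · exact ⟨⟨s, false⟩, rfl, by simpa [Corner.vert] using h⟩
  · exact ⟨⟨s, true⟩, rfl, by simp [Corner.vert, h]⟩

theorem Corner.side_edge (c : X.Corner) : c.side.edge = c.vert.edge := by
  unfold Corner.vert Side.edge
  split <;> simp

theorem Corner.horiz_origin (c : X.Corner) : c.horiz.origin = c.vert.fst := by
  obtain ⟨s, δ⟩ := c
  cases δ <;> rfl

theorem pow_le_two_pow_of_add_le {c n F : ℕ} (h : n + 2 * c ≤ 2 * F) :
    c ^ n ≤ 2 ^ (F * (F + 1) / 2) := by
  rcases Nat.eq_zero_or_pos c with rfl | hc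
  · exact (pow_le_one₀ le_rfl zero_le_one).trans Nat.one_le_two_pow
  obtain ⟨b, rfl⟩ : ∃ b, c = b + 1 := ⟨c - 1, by omega⟩
  calc (b + 1) ^ n ≤ (2 ^ b) ^ n := Nat.pow_le_pow_left Nat.lt_two_pow_self n
    _ = 2 ^ (b * n) := (pow_mul _ _ _).symm
    _ ≤ 2 ^ (F * (F + 1) / 2) := by
      refine Nat.pow_le_pow_right two_pos ((Nat.le_div_iff_mul_le two_pos).2 ?_)
      zify at h ⊢
      have hb : (0 : ℤ) ≤ b := b.cast_nonneg
      -- `4 b (F - 1 - b) ≤ (F - 1) ^ 2` by the inequality of the means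
      nlinarith [mul_le_mul_of_nonneg_left h hb, sq_nonneg ((F : ℤ) - 1 - 2 * b)]

/-! ### Vertical paths -/

namespace VerticalPath

variable (P : X.VerticalPath)

theorem edge_ne_of_succ {i j : Fin P.len} (h : (j : ℕ) = i + 1) : P.edge i ≠ P.edge j := by
  have hv : i.succ = j.castSucc := by ext; simp [h]
  intro he
  rcases Sym2.eq_iff.1 he with ⟨h1, -⟩ | ⟨h1, -⟩
  · refine (P.adj i).ne (h1.trans ?_)
    rw [hv]
    rfl
  · exact P.immersed i j h h1

theorem edge_ne_of_succ_succ {i j : Fin P.len} (h : (j : ℕ) = i + 2) : P.edge i ≠ P.edge j := by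
  let l : Fin P.len := ⟨i + 1, by omega⟩
  have h1 : i.succ = l.castSucc := by ext; simp [l]
  have h2 : l.succ = j.castSucc := by ext; simp [h, l]
  intro he
  rcases Sym2.eq_iff.1 he with ⟨h3, -⟩ | ⟨-, h3⟩
  · exact P.immersed i l rfl (h3.trans (by rw [h2]; rfl))
  · refine (P.adj l).ne ?_
    rw [← h1, h2]
    exact h3

theorem uses_iff {i j : Fin P.len} (h : (j : ℕ) = i + 1) {m : Fin (P.len + 1)}
    (hi : m = i.succ) {x : X.HalfEdge} :
    P.Uses m x ↔ x = .vertical (P.dart i).symm ∨ x = .vertical (P.dart j) := by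
  have hj : m = j.castSucc := by rw [hi]; ext; simp [h]
  constructor
  · rintro ⟨l, ⟨hl, hx⟩ | ⟨hl, hx⟩⟩
    · obtain rfl : j = l := Fin.castSucc_injective _ (hj.symm.trans hl)
      exact Or.inr hx
    · obtain rfl : i = l := Fin.succ_injective _ (hi.symm.trans hl)
      exact Or.inl hx
  · rintro (hx | hx)
    · exact ⟨i, Or.inr ⟨hi, hx⟩⟩
    · exact ⟨j, Or.inl ⟨hj, hx⟩⟩

theorem not_uses_horiz (j : Fin (P.len + 1)) (c : X.Corner) : ¬ P.Uses j c.horiz := by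
  rintro ⟨i, ⟨-, h⟩ | ⟨-, h⟩⟩ <;> cases h

end VerticalPath

namespace CyclicPath

variable (P : X.CyclicPath)

/-! ### The orthogonal sphere -/

/-- The vertices of the regular sphere which lie on a vertical half-edge or inside a corner, at the
initial or at the terminal vertex of the path. All vertices of the first cubical neighbourhoods of
`bu` and `av` are of this kind. -/
def NearEnd : P.SphereVertex → Prop
  | .onHalfEdge j (.vertical _) _ _ => j = 0 ∨ j = Fin.last P.len
  | .onHalfEdge _ (.horizontal _ _ _) _ _ => False
  | .inCorner j _ _ _ => j = 0 ∨ j = Fin.last P.len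
  | .along _ _ _ _ => False

theorem nearEnd_of_mem_cubicalNbhd {x : P.SphereVertex} {j : Fin (P.len + 1)} {d : X.graph.Dart}
    (ho : (HalfEdge.vertical d).origin = P.vertex j) (hoff : ¬ P.Uses j (.vertical d))
    (hj : j = 0 ∨ j = Fin.last P.len)
    (hx : x ∈ (P.regularSphere.singletonSubgraph
      (.onHalfEdge j (.vertical d) ho hoff)).cubicalNbhd.verts) : P.NearEnd x := by
  rcases hx with rfl | ⟨y, rfl, -, h | h⟩
  · exact hj
  · cases h
    exact hj
  · cases h

theorem orthogonalSphere_adj {x y : P.SphereVertex} (h : P.regularSphere.Adj x y)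
    (hx : ¬ P.NearEnd x) (hy : ¬ P.NearEnd y) : P.orthogonalSphere.Adj x y := by
  refine ⟨h, ?_⟩
  rintro (⟨-, h | h⟩ | ⟨-, h | h⟩)
  · exact hx (P.nearEnd_of_mem_cubicalNbhd _ _ (Or.inl rfl) h)
  · exact hy (P.nearEnd_of_mem_cubicalNbhd _ _ (Or.inl rfl) h)
  · exact hx (P.nearEnd_of_mem_cubicalNbhd _ _ (Or.inr rfl) h)
  · exact hy (P.nearEnd_of_mem_cubicalNbhd _ _ (Or.inr rfl) h)

theorem orthogonalSphere_adj_of_rel {x y : P.SphereVertex} (h : P.SphereRel x y) (hne : x ≠ y)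
    (hx : ¬ P.NearEnd x) (hy : ¬ P.NearEnd y) : P.orthogonalSphere.Adj x y :=
  P.orthogonalSphere_adj ((SimpleGraph.fromRel_adj _ _ _).2 ⟨hne, Or.inl h⟩) hx hy

variable {P} in
theorem mem_supp_of_adj {K : P.orthogonalSphere.coe.ConnectedComponent} {x y : P.SphereVertex}
    (h : P.orthogonalSphere.Adj x y) (hx : x ∈ Subtype.val '' K.supp) :
    y ∈ Subtype.val '' K.supp := by
  obtain ⟨x, hx, rfl⟩ := hx
  refine ⟨⟨y, h.snd_mem⟩, ?_, rfl⟩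
  rw [SimpleGraph.ConnectedComponent.mem_supp_iff] at hx ⊢
  rw [← hx]
  exact SimpleGraph.ConnectedComponent.sound
    (SimpleGraph.Adj.reachable (SimpleGraph.Subgraph.Adj.coe h.symm))

variable {P} in
theorem component_eq_of_mem {K L : P.orthogonalSphere.coe.ConnectedComponent}
    {x : P.SphereVertex} (hK : x ∈ Subtype.val '' K.supp) (hL : x ∈ Subtype.val '' L.supp) :
    K = L := by
  obtain ⟨x, hx, rfl⟩ := hK
  obtain ⟨y, hy, hxy⟩ := hL
  obtain rfl := Subtype.ext hxy
  exact hx.symm.trans hy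

theorem adj_along_zero (j : Fin P.len) (s : X.Side) (hs : s.edge = P.edge j) :
    P.orthogonalSphere.Adj (.along j s hs 0) (.along j s hs 1) :=
  P.orthogonalSphere_adj_of_rel (.along_zero j s hs) (by simp) id id

theorem adj_along_one (j : Fin P.len) (s : X.Side) (hs : s.edge = P.edge j) :
    P.orthogonalSphere.Adj (.along j s hs 1) (.along j s hs 2) :=
  P.orthogonalSphere_adj_of_rel (.along_one j s hs) (by simp) id id

/-- The component of the orthogonal sphere that contains the pre-image, around the `j`-th edge of
the path, of the square having the side `s`. -/
def sideComponent (j : Fin P.len) (s : {s : X.Side // s.edge = P.edge j}) :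
    P.orthogonalSphere.coe.ConnectedComponent :=
  P.orthogonalSphere.coe.connectedComponentMk
    ⟨.along j s.1 s.2 1, (P.adj_along_one j s.1 s.2).fst_mem⟩

theorem squarePreimage_subset (j : Fin P.len) (s : {s : X.Side // s.edge = P.edge j}) :
    P.squarePreimage j s.1 ⊆ Subtype.val '' (P.sideComponent j s).supp := by
  obtain ⟨s, hs⟩ := s
  have h1 : VerticalPath.SphereVertex.along j s hs 1 ∈
      Subtype.val '' (P.sideComponent j ⟨s, hs⟩).supp := ⟨_, rfl, rfl⟩
  have h0 := mem_supp_of_adj (P.adj_along_zero j s hs).symm h1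
  have h2 := mem_supp_of_adj (P.adj_along_one j s hs) h1
  rintro x (⟨hmem, t, rfl⟩ | ⟨c, ho, hoff, rfl, hc, rfl⟩ | ⟨c, ho, hoff, rfl, hc, rfl⟩)
  · fin_cases t
    exacts [h0, h1, h2]
  · exact mem_supp_of_adj (P.orthogonalSphere_adj_of_rel
      (.along_start j c hc hs ho hoff) (by simp) id id).symm h0
  · exact mem_supp_of_adj (P.orthogonalSphere_adj_of_rel
      (.along_end j c hc hs ho hoff) (by simp) id id) h2

/-! ### Crossing a vertex of the path -/

/-- If the two half-edges of the path at its interior vertex `m` are `d` and `d'`, then a component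
of the orthogonal sphere that contains a horizontal half-edge at `m` also contains one which belongs
to a corner at `d'`: it can be reached inside the link of `m`, which `d` does not separate. -/
theorem exists_corner_mem (hX : X.IsBradyMeier) {m : Fin (P.len + 1)}
    (hm : ¬ (m = 0 ∨ m = Fin.last P.len)) {d d' : X.graph.Dart}
    (hd : d.fst = P.vertex m) (hd' : d'.fst = P.vertex m) (hne : d ≠ d')
    (huses : ∀ x, P.Uses m x ↔ x = .vertical d ∨ x = .vertical d')
    {K : P.orthogonalSphere.coe.ConnectedComponent} (c : X.Corner) (ho : c.horiz.origin = P.vertex m)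
    (hoff : ¬ P.Uses m c.horiz)
    (hK : VerticalPath.SphereVertex.onHalfEdge m c.horiz ho hoff ∈ Subtype.val '' K.supp) :
    ∃ c' : X.Corner, c'.vert = d' ∧ ∃ (ho' : c'.horiz.origin = P.vertex m) (hoff' : _),
      VerticalPath.SphereVertex.onHalfEdge m c'.horiz ho' hoff' ∈ Subtype.val '' K.supp := by
  by_contra! hcon
  -- Around an interior vertex of the path, no vertex of the sphere is near an end.
  have hmid (h : X.HalfEdge) (ho hoff) : ¬ P.NearEnd (.onHalfEdge m h ho hoff) := by
    cases h
    exacts [hm, id]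
  -- The two edges of the regular sphere inside a corner that is disjoint from the path.
  have hvert (c' : X.Corner) (ho₁ hoff₁ ho₂ hoff₂) : P.orthogonalSphere.Adj
      (.inCorner m c' ho₁ hoff₁) (.onHalfEdge m (.vertical c'.vert) ho₂ hoff₂) :=
    P.orthogonalSphere_adj_of_rel (.corner_vert ..) (by simp) hm (hmid _ _ _)
  have hhoriz (c' : X.Corner) (ho₁ hoff₁ ho₂ hoff₂) : P.orthogonalSphere.Adj
      (.inCorner m c' ho₁ hoff₁) (.onHalfEdge m c'.horiz ho₂ hoff₂) :=
    P.orthogonalSphere_adj_of_rel (.corner_horiz ..) (by simp) hm (hmid _ _ _)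
  let σ : Set {h : X.HalfEdge // h.origin = P.vertex m} := {⟨.vertical d, hd⟩}
  have hconn : ((X.link (P.vertex m)).induce σᶜ).Connected :=
    (hX (P.vertex m)).2 σ (Set.singleton_nonempty _) (Set.pairwise_singleton _ _)
  -- Were the conclusion false, the part of `K` around `m` would be closed under adjacency in the
  -- link without `d`.
  have hstep : ∀ {x y : (σᶜ : Set _)}, ((X.link (P.vertex m)).induce σᶜ).Walk x y →
      (∃ hoff, VerticalPath.SphereVertex.onHalfEdge m x.1.1 x.1.2 hoff ∈
        Subtype.val '' K.supp) →
      ∃ hoff, VerticalPath.SphereVertex.onHalfEdge m y.1.1 y.1.2 hoff ∈ Subtype.val '' K.supp := by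
    intro x y w
    induction w with
    | nil => exact id
    | @cons x y z hxy _ ih =>
      rintro ⟨hoffx, hx⟩
      apply ih
      obtain ⟨⟨x, hxo⟩, hxσ⟩ := x
      obtain ⟨⟨y, hyo⟩, hyσ⟩ := y
      obtain ⟨-, ⟨c', h1, h2⟩ | ⟨c', h1, h2⟩⟩ := hxy
      · dsimp only at h1 h2 hx hoffx
        subst h1 h2
        exact ⟨P.not_uses_horiz m c',
          mem_supp_of_adj (hhoriz c' hxo hoffx _ _) (mem_supp_of_adj (hvert ..).symm hx)⟩
      · dsimp only at h1 h2 hx hoffx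
        subst h1 h2
        have hoffy : ¬ P.Uses m (.vertical c'.vert) := by
          rw [huses]
          rintro (h | h)
          · exact hyσ (Subtype.ext h)
          · exact hcon c' (HalfEdge.vertical.inj h) hxo hoffx hx
        exact ⟨hoffy,
          mem_supp_of_adj (hvert c' hyo hoffy _ _) (mem_supp_of_adj (hhoriz ..).symm hx)⟩
  have hcσ : (⟨c.horiz, ho⟩ : {h : X.HalfEdge // h.origin = P.vertex m}) ∈ σᶜ := by
    intro h
    cases congrArg Subtype.val h
  have hdσ : (⟨.vertical d', hd'⟩ : {h : X.HalfEdge // h.origin = P.vertex m}) ∈ σᶜ := by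
    intro h
    exact hne (HalfEdge.vertical.inj (congrArg Subtype.val h)).symm
  obtain ⟨w⟩ := hconn.preconnected ⟨_, hcσ⟩ ⟨_, hdσ⟩
  obtain ⟨h, -⟩ := hstep w ⟨hoff, hK⟩
  exact h ((huses _).2 (Or.inr rfl))

theorem range_sideComponent_succ (hX : X.IsBradyMeier) {i j : Fin P.len} (h : (j : ℕ) = i + 1) :
    Set.range (P.sideComponent i) = Set.range (P.sideComponent j) := by
  have hij : i.succ = j.castSucc := by ext; simp [h]
  have hm : ¬ (i.succ = 0 ∨ i.succ = Fin.last P.len) := by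
    simp only [Fin.ext_iff, Fin.val_succ, Fin.val_last, Fin.val_zero]
    omega
  have hi : (P.dart i).symm.fst = P.vertex i.succ := rfl
  have hj : (P.dart j).fst = P.vertex i.succ := by rw [hij]; rfl
  have hne : (P.dart i).symm ≠ P.dart j := fun he =>
    P.edge_ne_of_succ h (by
      change (P.dart i).edge = (P.dart j).edge
      rw [← he, SimpleGraph.Dart.edge_symm])
  have huses (x : X.HalfEdge) := P.uses_iff h rfl (x := x)
  apply Set.Subset.antisymm
  · rintro K ⟨⟨s, hs⟩, rfl⟩
    obtain ⟨c, rfl, hc⟩ := exists_corner s (P.dart i).symm (by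
      rw [SimpleGraph.Dart.edge_symm]; exact hs)
    have ho : c.horiz.origin = P.vertex i.succ := by rw [c.horiz_origin, hc, hi]
    obtain ⟨c', hc', ho', hoff', hK⟩ := P.exists_corner_mem hX hm hi hj hne huses c ho
      (P.not_uses_horiz _ c)
      (P.squarePreimage_subset i ⟨_, hs⟩ (Or.inr (Or.inr ⟨c, ho, _, rfl, hc, rfl⟩)))
    have hs' : c'.side.edge = P.edge j := by rw [c'.side_edge, hc']; rfl
    refine ⟨⟨c'.side, hs'⟩, component_eq_of_mem
      (P.squarePreimage_subset j ⟨_, hs'⟩ (Or.inr (Or.inl ⟨c', ?_, ?_, rfl, hc', ?_⟩))) hK⟩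
    · rw [← hij]; exact ho'
    · exact P.not_uses_horiz _ c'
    · congr 1
  · rintro K ⟨⟨s, hs⟩, rfl⟩
    obtain ⟨c, rfl, hc⟩ := exists_corner s (P.dart j) hs
    have ho : c.horiz.origin = P.vertex i.succ := by rw [c.horiz_origin, hc, hj]
    obtain ⟨c', hc', ho', hoff', hK⟩ := P.exists_corner_mem hX hm hj hi hne.symm
      (fun x => (huses x).trans or_comm) c ho (P.not_uses_horiz _ c)
      (P.squarePreimage_subset j ⟨_, hs⟩ (Or.inr (Or.inl ⟨c, by rw [← hij]; exact ho,
        P.not_uses_horiz _ c, rfl, hc, by congr 1⟩)))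
    have hs' : c'.side.edge = P.edge i := by
      rw [c'.side_edge, hc', SimpleGraph.Dart.edge_symm]; rfl
    exact ⟨⟨c'.side, hs'⟩, component_eq_of_mem
      (P.squarePreimage_subset i ⟨_, hs'⟩ (Or.inr (Or.inr ⟨c', ho', hoff', rfl, hc', rfl⟩))) hK⟩

/-- Each component of the orthogonal sphere that contains a square around one edge of the path
contains a square around every edge. -/
theorem range_sideComponent_eq (hX : X.IsBradyMeier) (i : Fin P.len) :
    Set.range (P.sideComponent i) = Set.range (P.sideComponent P.first) := by
  obtain ⟨i, hi⟩ := i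
  induction i with
  | zero => rfl
  | succ i ih =>
    rw [← ih (by omega)]
    exact (P.range_sideComponent_succ hX rfl).symm

/-! ### Counting colourings -/

theorem card_range_le (hX : X.IsBradyMeier) (i : Fin P.len) :
    Nat.card (Set.range (P.sideComponent P.first)) ≤
      Nat.card {s : X.Side // s.edge = P.edge i} := by
  have := X.finite_side
  rw [← P.range_sideComponent_eq hX i]
  exact Finite.card_range_le _

theorem card_sides_add_le (hX : X.IsBradyMeier) (h3 : 3 ≤ P.len) (i : Fin P.len) :
    Nat.card {s : X.Side // s.edge = P.edge i} +
      2 * Nat.card (Set.range (P.sideComponent P.first)) ≤ 2 * X.numSquares := by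
  -- Three consecutive edges, one of which is the `i`-th one.
  obtain ⟨a, b, c, hab, hac, hi⟩ : ∃ a b c : Fin P.len, (b : ℕ) = a + 1 ∧ (c : ℕ) = a + 2 ∧
      (i = a ∨ i = b ∨ i = c) := by
    by_cases h : (i : ℕ) + 2 < P.len
    · exact ⟨i, ⟨i + 1, by omega⟩, ⟨i + 2, h⟩, rfl, rfl, Or.inl rfl⟩
    · refine ⟨⟨P.len - 3, by omega⟩, ⟨P.len - 2, by omega⟩, ⟨P.len - 1, by omega⟩, ?_, ?_, ?_⟩ <;>
        simp only [Fin.ext_iff] <;> omega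
  have hsum := card_sides_add_three_le (X := X) (P.edge_ne_of_succ hab)
    (P.edge_ne_of_succ_succ hac) (P.edge_ne_of_succ (i := b) (j := c) (by omega))
  have ha := P.card_range_le hX a
  have hb := P.card_range_le hX b
  have hc := P.card_range_le hX c
  rcases hi with rfl | rfl | rfl <;> omega

theorem exists_embedding (hX : X.IsBradyMeier) (h3 : 3 ≤ P.len) (k : ℕ)
    (hlen : X.numVerticalEdges * (k - 1) * 2 ^ (X.numSquares * (X.numSquares + 1) / 2) + 1
      ≤ P.len) :
    ∃ e ∈ X.graph.edgeSet, ∃ i : Fin k ↪ Fin P.len, (∀ m, P.edge (i m) = e) ∧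
      ∀ s : X.Side, s.edge = e → ∃ K : P.orthogonalSphere.coe.ConnectedComponent,
        ∀ m, P.squarePreimage (i m) s ⊆ Subtype.val '' K.supp := by
  classical
  have := X.finite_V
  have := X.finite_side
  have := Fintype.ofFinite X.graph.edgeSet
  set T := 2 ^ (X.numSquares * (X.numSquares + 1) / 2)
  obtain ⟨⟨e, he⟩, hcard⟩ := Fintype.exists_lt_card_fiber_of_mul_lt_card
    (f := fun j : Fin P.len => (⟨P.edge j, (P.dart j).edge_mem⟩ : X.graph.edgeSet))
    (n := (k - 1) * T) (by
      rw [← Nat.card_eq_fintype_card, Fintype.card_fin]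
      change X.numVerticalEdges * _ < _
      rw [← mul_assoc]
      omega)
  have hfiber (j) (hj : j ∈ Finset.univ.filter fun j : Fin P.len =>
      (⟨P.edge j, (P.dart j).edge_mem⟩ : X.graph.edgeSet) = ⟨e, he⟩) : P.edge j = e :=
    congrArg Subtype.val (Finset.mem_filter.1 hj).2
  let R := Set.range (P.sideComponent P.first)
  have : Finite R := Set.finite_range _
  have := Fintype.ofFinite ({s : X.Side // s.edge = e} → R)
  let colour (j : {j // P.edge j = e}) (s : {s : X.Side // s.edge = e}) : R :=
    ⟨P.sideComponent j.1 ⟨s.1, s.2.trans j.2.symm⟩, by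
      change _ ∈ Set.range (P.sideComponent P.first)
      rw [← P.range_sideComponent_eq hX j.1]
      exact ⟨_, rfl⟩⟩
  have hcolours : Fintype.card ({s : X.Side // s.edge = e} → R) ≤ T := by
    obtain ⟨j, hj⟩ := Finset.card_pos.1 (Nat.zero_lt_of_lt hcard)
    obtain rfl := hfiber j hj
    rw [← Nat.card_eq_fintype_card, Nat.card_fun]
    exact pow_le_two_pow_of_add_le (P.card_sides_add_le hX h3 j)
  obtain ⟨y, hy⟩ := Fintype.exists_lt_card_fiber_of_mul_lt_card (f := colour) (n := k - 1) (by
    rw [Fintype.card_subtype, mul_comm]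
    exact (Nat.mul_le_mul_left _ hcolours).trans_lt
      (hcard.trans_le (Finset.card_le_card fun j hj => by simpa using hfiber j hj)))
  obtain ⟨f⟩ : Nonempty (Fin k ↪ {j // colour j = y}) :=
    Function.Embedding.nonempty_of_card_le (by
      rw [Fintype.card_fin, Fintype.card_subtype]
      omega)
  refine ⟨e, he, f.trans ((Function.Embedding.subtype _).trans (Function.Embedding.subtype _)),
    fun m => (f m).1.2, fun s hs => ⟨(y ⟨s, hs⟩).1, fun m => ?_⟩⟩
  have h := P.squarePreimage_subset (f m).1.1 ⟨s, hs.trans (f m).1.2.symm⟩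
  have hcol : P.sideComponent (f m).1.1 ⟨s, hs.trans (f m).1.2.symm⟩ = (y ⟨s, hs⟩).1 :=
    congrArg Subtype.val (congrFun (f m).2 ⟨s, hs⟩)
  rwa [hcol] at h

end CyclicPath

/-! ### Fundamental domains -/

theorem Cycle.three_le_len (C : X.Cycle) : 3 ≤ C.len := by
  obtain ⟨n, hn, vert, adj, imm⟩ := C
  match n, hn with
  | 1, _ => exact absurd (congrArg vert (Subsingleton.elim _ _)) (imm 0)
  | 2, _ => exact absurd rfl (imm 0)
  | n + 3, _ => exact Nat.le_add_left 3 n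

/-- Cutting a vertical cycle at its vertex `0` yields a fundamental domain. -/
def Cycle.cut (C : X.Cycle) : X.CyclicPath where
  len := C.len
  vertex j := C.vertex (j : ℕ)
  adj j := by simpa using C.adj (j : ℕ)
  immersed i j h := by
    have := C.immersed (i : ℕ)
    simpa [h, add_assoc, one_add_one_eq_two] using this
  len_pos := C.len_pos
  closed := by simp
  ends := by
    have h1 : ((C.len - 1 : ℕ) : ZMod C.len) = -1 := by
      rw [Nat.cast_sub C.len_pos]
      simp
    have hadj := C.adj (-1)
    have himm := C.immersed (-1)
    intro h
    rcases Sym2.eq_iff.1 h with ⟨h, -⟩ | ⟨-, h⟩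
    · refine hadj.ne ?_
      change C.vertex ((0 : ℕ) : ZMod C.len) = C.vertex ((C.len - 1 : ℕ) : ZMod C.len) at h
      simpa [h1] using h.symm
    · refine himm ?_
      have h2 : (-1 + 2 : ZMod C.len) = 1 := by ring
      change C.vertex ((0 + 1 : ℕ) : ZMod C.len) = C.vertex ((C.len - 1 : ℕ) : ZMod C.len) at h
      rw [h2]
      simpa [h1] using h.symm

theorem Cycle.cut_isFundamentalDomain (C : X.Cycle) : C.cut.IsFundamentalDomain C :=
  ⟨rfl, 0, Or.inl fun j => by rw [zero_add]; rfl⟩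

end TubularGraphOfGraphs

theorem mainTheorem7 {V : Type*} {A : Type*} (X : TubularGraphOfGraphs V A)
    (hX : X.IsBradyMeier) (k : ℕ) (hk : 1 ≤ k) (C : X.Cycle) (hC : C.IsUCSeparating)
    (hlen : X.numVerticalEdges * (k - 1) * 2 ^ (X.numSquares * (X.numSquares + 1) / 2) + 1
      ≤ C.len) :
    C.IsRepetitive k := by
  obtain ⟨e, he, i, hi⟩ := C.cut.exists_embedding hX C.three_le_len k hlen
  exact ⟨hC, e, he, C.cut, C.cut_isFundamentalDomain, i, hi⟩
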